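/- Let $T>0$, $r\ge 0$, $\sigma>0$, $x_0>0$, and let $\mathcal T=(\tau_n)_{n\ge 0}$ be a sequence of partitions $\tau_n=\{0=t_{n,0}<\dots<t_{n,K(n)}=T\}$ of $[0,T]$ whose mesh tends to $0$. A continuous function $z:[0,T]\to\mathbb R$ has quadratic variation $[z]^{\mathcal T}_t=t$ if the measures $\sum_i (z(t_{n,i+1})-z(t_{n,i}))^2\,\varepsilon_{t_{n,i}}$ converge weakly, as $n\to\infty$, to the measure on $[0,T]$ with distribution function $t$. Let $\mathcal J^\sigma_\tau(x_0)$ be the class of functions $x(t)=x_0e^{\sigma z(t)}$, $0\le t\le T$, with $z$ continuous, $z(0)=0$ and $[z]^{\mathcal T}_t=t$ for $0\le t\le T$. For $0\le t<T$ the Föllmer integral is $$\int_0^t y(s)\,dx_s=\lim_{n\to\infty}\sum_{t_{n,i}\le t}y(t_{n,i})\,\bigl(x(t_{n,i+1})-x(t_{n,i})\bigr),$$ and $\int_0^T y(s)\,dx_s=\lim_{t\uparrow T}\int_0^t y(s)\,dx_s$, provided that these limits exist. Let $\mathcal J^*\subset\mathcal J^\sigma_\tau(x_0)$ be any subclass and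 let $h:(0,\infty)\to\mathbb R$ be Lipschitz. Let $v:[0,T]\times(0,\infty)\to\mathbb R$ be a classical solution (continuous on $[0,T]\times(0,\infty)$ and of class $C^{1,2}$ on $[0,T)\times(0,\infty)$) of the Black–Scholes equation $$\frac{\partial v}{\partial t}+r x\frac{\partial v}{\partial x}+\frac{\sigma^2x^2}{2}\frac{\partial^2 v}{\partial x^2}-r v=0\quad\text{on }[0,T)\times(0,\infty),\qquad v(T,x)=h(x).$$ Put $\varrho=\partial v/\partial x$ (with an arbitrary value wherever this derivative does not exist at $t=T$) and consider the delta-hedging portfolio $\Phi=(\psi,\phi)$, $$\psi(t,x)=v(t,x(t))-\varrho(t,x(t))\,x(t),\qquad \phi(t,x)=\varrho(t,x(t)),$$ with value $V_\Phi(t,x)=\psi(t,x)+\phi(t,x)\,x(t)$. Then $\Phi$ is an NP-portfolio on $\mathcal J^*$ (that is, $\Phi(0,x)=\Phi(0,x')$ for all $x,x'\in\mathcal J^*$) that replicates the payoff $h$ at maturity $T$ for every $x\in\mathcal J^*$: it is self-financing, i.e. for every $x\in\mathcal J^*$ and every $t\in[0,T]$ the integral $\int_0^t\psi(s,x)\,ds$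 and the Föllmer integral $\int_0^t\phi(s,x)\,dx_s$ exist and $$V_\Phi(t,x)=V_\Phi(0,x)+\int_0^t\psi(s,x)\,r\,ds+\int_0^t\phi(s,x)\,dx_s,$$ and $V_\Phi(T,x)=h(x(T))$. -/

import Mathlib

open Set Filter Topology MeasureTheory
open scoped NNReal ENNReal BoundedContinuousFunction

/-- A sequence of partitions `0 = t_{n,0} < ⋯ < t_{n,K(n)} = T` of `[0,T]` whose mesh tends to `0`.
The values `pt n i` with `K n < i` are irrelevant. The partitions need not be nested. -/
structure PartitionSeq (T : ℝ) where
  K : ℕ → ℕ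
  pt : ℕ → ℕ → ℝ
  pt_zero : ∀ n, pt n 0 = 0
  pt_last : ∀ n, pt n (K n) = T
  pt_lt : ∀ n, ∀ i < K n, pt n i < pt n (i + 1)
  mesh_tendsto : Tendsto (fun n => ⨆ i : Fin (K n), (pt n (i + 1) - pt n i)) atTop (𝓝 0)

/-- The discrete measure `ξ_n = ∑ (x(t_{i+1}) - x(t_i))² ε_{t_i}` along the `n`-th partition. -/
noncomputable def discreteQV {T : ℝ} (τ : PartitionSeq T) (x : ℝ → ℝ) (n : ℕ) : Measure ℝ :=
  ∑ i ∈ Finset.range (τ.K n),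
    ENNReal.ofReal ((x (τ.pt n (i + 1)) - x (τ.pt n i)) ^ 2) • Measure.dirac (τ.pt n i)

/-- The jump `Δx_t = x_t - x_{t-}` of a path indexed by `[0,T]`; there is no jump at time `0`. -/
noncomputable def pathJump (x : ℝ → ℝ) (t : ℝ) : ℝ :=
  if 0 < t then x t - Function.leftLim x t else 0

/-- The path `x` is of quadratic variation along `τ`, with limit measure `ξ`: the discrete measures
`ξ_n` converge weakly to the finite measure `ξ` carried by `[0,T]`, and the atoms of `ξ` are the
squared jumps of `x`. -/
structure HasQuadraticVariation {T : ℝ} (τ : PartitionSeq T) (x : ℝ → ℝ) (ξ : Measure ℝ) :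
    Prop where
  finite : IsFiniteMeasure ξ
  carried : ξ (Icc 0 T)ᶜ = 0
  weak_limit : ∀ f : ℝ →ᵇ ℝ,
    Tendsto (fun n => ∫ s, f s ∂(discreteQV τ x n)) atTop (𝓝 (∫ s, f s ∂ξ))
  atoms : ∀ t ∈ Icc (0 : ℝ) T, ξ {t} = ENNReal.ofReal (pathJump x t ^ 2)

/-- The continuous functions `z` on `[0,T]` with `z(0) = 0` and `[z]_t = t` for `0 ≤ t ≤ T`, where
`[z]_t = ξ([0,t])` is the distribution function of the limit measure. -/
def unitQVPaths {T : ℝ} (τ : PartitionSeq T) : Set (ℝ → ℝ) :=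
  {z | ContinuousOn z (Icc 0 T) ∧ z 0 = 0 ∧
    ∃ ξ : Measure ℝ, HasQuadraticVariation τ z ξ ∧
      ∀ t ∈ Icc (0 : ℝ) T, ξ (Icc 0 t) = ENNReal.ofReal t}

/-- The trajectory class `J_τ^σ(x₀)`: paths equal on `[0,T]` to `x₀ exp(σ z(t))`, where `z` is
continuous with `z(0) = 0` and `[z]_t = t`. -/
def trajectoryClass {T : ℝ} (τ : PartitionSeq T) (σ x₀ : ℝ) : Set (ℝ → ℝ) :=
  {x | ∃ z ∈ unitQVPaths τ, ∀ t ∈ Icc (0 : ℝ) T, x t = x₀ * Real.exp (σ * z t)}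

/-- The sum of `y(t_{n,i}) (x(t_{n,i+1}) - x(t_{n,i}))` over the points `t_{n,i} ≤ t` of the `n`-th
partition that have a successor (for `t < T` these are all the points `t_{n,i} ≤ t`). -/
noncomputable def follmerSum {T : ℝ} (τ : PartitionSeq T) (y x : ℝ → ℝ) (t : ℝ) (n : ℕ) : ℝ :=
  ∑ i ∈ (Finset.range (τ.K n)).filter (fun i => τ.pt n i ≤ t),
    y (τ.pt n i) * (x (τ.pt n (i + 1)) - x (τ.pt n i))

/-- The Föllmer integral `∫_0^t y dx` exists and equals `I`: for `t < T` it is the limit of the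
sums along the partitions; over `[0,T]` it is the improper integral, the limit of `∫_0^u y dx` as
`u ↑ T`, where all the integrals with `0 < u < T` exist. -/
def HasFollmerIntegral {T : ℝ} (τ : PartitionSeq T) (y x : ℝ → ℝ) (t I : ℝ) : Prop :=
  (t < T ∧ Tendsto (fun n => follmerSum τ y x t n) atTop (𝓝 I)) ∨
  (t = T ∧ ∃ F : ℝ → ℝ,
    (∀ u ∈ Ioo 0 T, Tendsto (fun n => follmerSum τ y x u n) atTop (𝓝 (F u))) ∧
    Tendsto F (𝓝[<] T) (𝓝 I))

/-- `Φ = (ψ, φ)` is an NP-portfolio on the class `J`: its initial position is the same for all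
trajectories of `J`. Here `ψ` is the bond position and `φ` the number of shares. -/
def IsNPPortfolio (J : Set (ℝ → ℝ)) (Φ : ℝ → (ℝ → ℝ) → ℝ × ℝ) : Prop :=
  ∀ x ∈ J, ∀ x' ∈ J, Φ 0 x = Φ 0 x'

/-- The value `V_Φ(t,x) = ψ(t,x) + φ(t,x) x(t)`. -/
def portfolioValue (Φ : ℝ → (ℝ → ℝ) → ℝ × ℝ) (t : ℝ) (x : ℝ → ℝ) : ℝ :=
  (Φ t x).1 + (Φ t x).2 * x t

/-- NP-self-financing with interest rate `r`: for every trajectory `x` of `J` and `t ∈ [0,T]` the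
integrals `∫_0^t ψ ds` and `∫_0^t φ dx` exist and
`V_Φ(t,x) = V_Φ(0,x) + ∫_0^t ψ r ds + ∫_0^t φ dx`. -/
def IsNPSelfFinancing {T : ℝ} (τ : PartitionSeq T) (r : ℝ) (J : Set (ℝ → ℝ))
    (Φ : ℝ → (ℝ → ℝ) → ℝ × ℝ) : Prop :=
  ∀ x ∈ J, ∀ t ∈ Icc 0 T,
    IntervalIntegrable (fun s => (Φ s x).1) volume 0 t ∧
    ∃ I : ℝ, HasFollmerIntegral τ (fun s => (Φ s x).2) x t I ∧
      portfolioValue Φ t x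
        = portfolioValue Φ 0 x + (∫ s in (0 : ℝ)..t, (Φ s x).1 * r) + I

/-- `v` is a classical solution on `[0,T] × (0,∞)` of the Black–Scholes equation
`v_t + r x v_x + (σ² x² / 2) v_xx - r v = 0` with terminal value `h`: it is continuous on
`[0,T] × (0,∞)`, of class `C^{1,2}` on `[0,T) × (0,∞)` (with one-sided time derivative at `0`), and
satisfies the equation there. -/
structure IsBlackScholesSolution (T r σ : ℝ) (h : ℝ → ℝ) (v : ℝ → ℝ → ℝ) : Prop where
  cont : ContinuousOn (fun p : ℝ × ℝ => v p.1 p.2) (Icc 0 T ×ˢ Ioi 0)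
  diff_t : ∀ t ∈ Ico 0 T, ∀ x ∈ Ioi (0 : ℝ),
    DifferentiableWithinAt ℝ (fun s => v s x) (Icc 0 T) t
  diff_x : ∀ t ∈ Ico 0 T, ∀ x ∈ Ioi (0 : ℝ), DifferentiableAt ℝ (v t) x
  diff_xx : ∀ t ∈ Ico 0 T, ∀ x ∈ Ioi (0 : ℝ), DifferentiableAt ℝ (deriv (v t)) x
  cont_t : ContinuousOn (fun p : ℝ × ℝ => derivWithin (fun s => v s p.2) (Icc 0 T) p.1)
    (Ico 0 T ×ˢ Ioi 0)
  cont_x : ContinuousOn (fun p : ℝ × ℝ => deriv (v p.1) p.2) (Ico 0 T ×ˢ Ioi 0)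
  cont_xx : ContinuousOn (fun p : ℝ × ℝ => deriv (deriv (v p.1)) p.2) (Ico 0 T ×ˢ Ioi 0)
  pde : ∀ t ∈ Ico 0 T, ∀ x ∈ Ioi (0 : ℝ),
    derivWithin (fun s => v s x) (Icc 0 T) t + r * x * deriv (v t) x
      + σ ^ 2 * x ^ 2 / 2 * deriv (deriv (v t)) x - r * v t x = 0
  terminal : ∀ x ∈ Ioi (0 : ℝ), v T x = h x

/-- The delta-hedging portfolio `Φ_t = (v(t,x(t)) - ϱ(t,x(t)) x(t), ϱ(t,x(t)))`, `ϱ = ∂v/∂x`. -/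
noncomputable def deltaHedge (v : ℝ → ℝ → ℝ) (t : ℝ) (x : ℝ → ℝ) : ℝ × ℝ :=
  (v t (x t) - deriv (v t) (x t) * x t, deriv (v t) (x t))

/-! Before maturity the result is pathwise Itô calculus. On each partition interval the increment of
`v` along the path is an integral of `v_t`, plus `v_x Δx`, plus `(σ² x² / 2) v_xx (Δz)²`, up to a
small multiple of `Δt + (Δz)²` (`local_expansion`). Summed over the interval, the left side
telescopes, weak convergence of the discrete quadratic variation turns the second-order terms into a
Lebesgue integral, and what remains, the Föllmer sum, must converge. The Black–Scholes equation
identifies its limit as `v(t, x(t)) - v(0, x(0)) - ∫ r (v - x v_x) ds` (`tendsto_follmerSum`).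

The difficulty is at maturity, where nothing is assumed about `v_x` and no growth condition on `v`
allows a global argument. The bond position must nevertheless be integrable up to `T`. This follows
from a local bound on `v_x`, uniform in `t < T` (`exists_abs_deriv_le`), obtained by doubling the
space variable: the maximum principle is applied to `v(t,x) - v(t,y)` minus a barrier that is
concave in `x - y`, and the Lipschitz payoff controls the barrier at `T`. The improper integral at
`T` then exists by continuity of `v` and of the primitive. -/

/-! ### Derivative conditions at a maximum -/

theorem IsLocalMax.deriv_deriv_nonpos {f : ℝ → ℝ} {a : ℝ} (hf : IsLocalMax f a)
    (hc : ContinuousAt f a) : deriv (deriv f) a ≤ 0 := by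
  by_contra! hpos
  -- With a positive second derivative, `a` would be both a local maximum and a local minimum, so
  -- `f` would be locally constant.
  have hmin : IsLocalMin f a := isLocalMin_of_deriv_deriv_pos hpos hf.deriv_eq_zero hc
  have heq : f =ᶠ[𝓝 a] fun _ => f a := by
    filter_upwards [hf, hmin] with y h1 h2 using le_antisymm h1 h2
  have h2 := heq.deriv.deriv_eq
  simp at h2
  exact hpos.ne' h2

/-- If `f` minus a quadratic polynomial has a local maximum, the first derivative of `f` agrees with
that of the polynomial and the second one is at most that of the polynomial. -/
theorem deriv_eq_and_deriv_deriv_le_of_isLocalMax_sub {f : ℝ → ℝ} {a α β : ℝ}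
    (hf : ∀ᶠ x in 𝓝 a, DifferentiableAt ℝ f x) (hf' : DifferentiableAt ℝ (deriv f) a)
    (hmax : IsLocalMax (fun x => f x - (α * (x - a) ^ 2 + β * (x - a))) a) :
    deriv f a = β ∧ deriv (deriv f) a ≤ 2 * α := by
  have hq : ∀ x, HasDerivAt (fun x => α * (x - a) ^ 2 + β * (x - a)) (2 * α * (x - a) + β) x := by
    intro x
    have h1 : HasDerivAt (fun x => x - a) 1 x := (hasDerivAt_id x).sub_const a
    have h := ((h1.pow 2).const_mul α).add (h1.const_mul β)
    have e : 2 * α * (x - a) + β = α * ((2 : ℕ) * (x - a) ^ (2 - 1) * 1) + β * 1 := by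
      norm_num; ring
    rw [e]
    exact h
  have hd : deriv (fun x => f x - (α * (x - a) ^ 2 + β * (x - a)))
      =ᶠ[𝓝 a] fun x => deriv f x - (2 * α * (x - a) + β) := by
    filter_upwards [hf] with x hx using (hx.hasDerivAt.sub (hq x)).deriv
  have hq' : HasDerivAt (fun x => 2 * α * (x - a) + β) (2 * α) a := by
    simpa using (((hasDerivAt_id a).sub_const a).const_mul (2 * α)).add_const β
  have h2 := hmax.deriv_deriv_nonpos
    ((hf.self_of_nhds.continuousAt).sub (hq a).continuousAt)
  rw [hd.deriv_eq, (hf'.hasDerivAt.fun_sub hq').deriv] at h2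
  have h1 := hmax.deriv_eq_zero
  rw [hd.self_of_nhds] at h1
  constructor <;> linarith

/-- Only slopes to the right are used, so the left endpoint is allowed. This suits a backward
equation: time `0` is not a boundary to be excluded. -/
theorem HasDerivWithinAt.nonpos_of_forall_le {f : ℝ → ℝ} {a b t p : ℝ}
    (hf : HasDerivWithinAt f p (Icc a b) t) (ht : t ∈ Ico a b) (hmax : ∀ s ∈ Icc a b, f s ≤ f t) :
    p ≤ 0 := by
  have h1 : HasDerivWithinAt f p (Ioo t b) t :=
    hf.mono fun s hs => ⟨ht.1.trans hs.1.le, hs.2.le⟩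
  rw [hasDerivWithinAt_iff_tendsto_slope' (by simp)] at h1
  have : (𝓝[Ioo t b] t).NeBot := by
    rw [nhdsWithin_Ioo_eq_nhdsGT ht.2]; infer_instance
  refine le_of_tendsto h1 ?_
  filter_upwards [self_mem_nhdsWithin] with s hs
  rw [slope_def_field]
  exact div_nonpos_of_nonpos_of_nonneg
    (sub_nonpos.2 (hmax s ⟨ht.1.trans hs.1.le, hs.2.le⟩)) (sub_nonneg.2 hs.1.le)

/-! ### Local gradient bound up to maturity -/

namespace IsBlackScholesSolution

variable {T r σ : ℝ} {h : ℝ → ℝ} {v : ℝ → ℝ → ℝ}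

/-- By linearity, upper estimates also give lower ones, and a minimum condition in the second
variable becomes a maximum condition. -/
theorem neg (hv : IsBlackScholesSolution T r σ h v) :
    IsBlackScholesSolution T r σ (-h) (fun t x => -v t x) := by
  have e1 : ∀ t, deriv (fun x => -v t x) = fun x => -deriv (v t) x := fun t => by
    ext x; exact deriv.fun_neg
  have e2 : ∀ t, deriv (deriv (fun x => -v t x)) = fun x => -deriv (deriv (v t)) x := fun t => by
    rw [e1]; ext x; exact deriv.fun_neg
  have e3 : ∀ t x, derivWithin (fun s => -v s x) (Icc 0 T) t
      = -derivWithin (fun s => v s x) (Icc 0 T) t := fun t x => derivWithin.fun_neg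
  constructor
  · exact hv.cont.neg
  · exact fun t ht x hx => (hv.diff_t t ht x hx).neg
  · exact fun t ht x hx => (hv.diff_x t ht x hx).neg
  · intro t ht x hx
    rw [e1]; exact (hv.diff_xx t ht x hx).neg
  · simp only [e3]; exact hv.cont_t.neg
  · simp only [e1]; exact hv.cont_x.neg
  · simp only [e2]; exact hv.cont_xx.neg
  · intro t ht x hx
    simp only [e1, e3]
    simp only [deriv.fun_neg']
    linarith [hv.pde t ht x hx]
  · exact fun x hx => by simp [hv.terminal x hx]

/-- Doubling of variables: a barrier for the increments of a solution in the space variable. -/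
theorem sub_le_barrier (hr : 0 ≤ r) (hσ : 0 < σ) {L : ℝ≥0}
    (hh : LipschitzOnWith L h (Ioi 0)) (hv : IsBlackScholesSolution T r σ h v) {c M A : ℝ}
    (hc : 0 < c) (hM : ∀ t ∈ Icc 0 T, ∀ x ∈ Icc (c / 2) (3 * c / 2), |v t x| ≤ M)
    (hAL : 2 * L ≤ A) (hA : 16 * M * (σ ^ 2 + 2 * r) < A * σ ^ 2 * c) {t x y : ℝ}
    (ht : t ∈ Icc 0 T) (hy : c / 2 ≤ y) (hyx : y ≤ x) (hx : x ≤ 3 * c / 2) :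
    v t x - v t y ≤ 8 * M / c ^ 2 * ((x - c) ^ 2 + (y - c) ^ 2)
      + A * ((x - y) - (x - y) ^ 2 / (2 * c)) := by
  have hL : (0 : ℝ) ≤ L := L.2
  have hA0 : 0 ≤ A := by linarith
  have hM0 : 0 ≤ M := (abs_nonneg _).trans (hM t ht y ⟨hy, hyx.trans hx⟩)
  -- `K (c/2)² = 2M` is the largest possible difference of values of `v`, which confines the maximum
  -- to the interior. With `k = 1/(2c)`, the concave profile `s - k s²` stays above `s/2` on `[0,
  -- c]`.
  set K := 8 * M / c ^ 2 with hK
  have hKM : K * c ^ 2 = 8 * M := by rw [hK]; field_simp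
  have hK0 : 0 ≤ K := by positivity
  set k := 1 / (2 * c) with hk
  have hkc : k * c = 1 / 2 := by rw [hk]; field_simp
  have hk0 : 0 < k := by positivity
  have hdiv : ∀ s : ℝ, s ^ 2 / (2 * c) = k * s ^ 2 := fun s => by rw [hk]; ring
  simp only [hdiv]
  have hgs : ∀ s, 0 ≤ s → s ≤ c → s / 2 ≤ s - k * s ^ 2 := by
    intro s hs hsc
    nlinarith [mul_le_mul_of_nonneg_left hsc (mul_nonneg hk0.le hs)]
  -- Restricting to `y ≤ x` keeps the barrier smooth: no absolute value of `x - y` is needed.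
  let D : Set (ℝ × ℝ × ℝ) := {p | p.1 ∈ Icc 0 T ∧ c / 2 ≤ p.2.2 ∧ p.2.2 ≤ p.2.1 ∧ p.2.1 ≤ 3 * c / 2}
  let B : ℝ → ℝ → ℝ := fun x y =>
    K * ((x - c) ^ 2 + (y - c) ^ 2) + A * ((x - y) - k * (x - y) ^ 2)
  let G : ℝ × ℝ × ℝ → ℝ := fun p => v p.1 p.2.1 - v p.1 p.2.2 - B p.2.1 p.2.2
  have hDcpt : IsCompact D := by
    refine (isCompact_Icc.prod (isCompact_Icc.prod isCompact_Icc) :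
      IsCompact (Icc (0 : ℝ) T ×ˢ (Icc (c / 2) (3 * c / 2) ×ˢ Icc (c / 2) (3 * c / 2))))
      |>.of_isClosed_subset ?_ ?_
    · refine IsClosed.and (isClosed_Icc.preimage continuous_fst) (IsClosed.and ?_ (IsClosed.and ?_ ?_))
      · exact isClosed_le (by fun_prop) (by fun_prop)
      · exact isClosed_le (by fun_prop) (by fun_prop)
      · exact isClosed_le (by fun_prop) (by fun_prop)
    · rintro p ⟨h1, h2, h3, h4⟩
      exact ⟨h1, ⟨h2.trans h3, h4⟩, ⟨h2, h3.trans h4⟩⟩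
  have hGcont : ContinuousOn G D := by
    refine ContinuousOn.sub (ContinuousOn.sub ?_ ?_) (by fun_prop)
    · refine hv.cont.comp (f := fun p : ℝ × ℝ × ℝ => (p.1, p.2.1)) (by fun_prop) ?_
      rintro p ⟨h1, h2, h3, h4⟩
      exact ⟨h1, show (0 : ℝ) < p.2.1 by linarith⟩
    · refine hv.cont.comp (f := fun p : ℝ × ℝ × ℝ => (p.1, p.2.2)) (by fun_prop) ?_
      rintro p ⟨h1, h2, h3, h4⟩
      exact ⟨h1, show (0 : ℝ) < p.2.2 by linarith⟩
  obtain ⟨⟨t₀, a, b⟩, ⟨ht₀, hb, hba, ha⟩, hmax⟩ :=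
    hDcpt.exists_isMaxOn ⟨(t, x, y), ht, hy, hyx, hx⟩ hGcont
  simp only at ht₀ hb hba ha
  have hGle : ∀ p ∈ D, G p ≤ G (t₀, a, b) := hmax
  suffices hG : G (t₀, a, b) ≤ 0 by
    have := hGle (t, x, y) ⟨ht, hy, hyx, hx⟩
    simp only [G, B] at this hG
    linarith
  by_contra! hG
  have hs := hgs (a - b) (by linarith) (by linarith)
  have hAs := mul_le_mul_of_nonneg_left hs hA0
  have hw : v t₀ a - v t₀ b ≤ 2 * M := by
    have h1 := abs_le.1 (hM t₀ ht₀ a ⟨by linarith, ha⟩)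
    have h2 := abs_le.1 (hM t₀ ht₀ b ⟨hb, by linarith⟩)
    linarith
  have hAs0 : 0 ≤ A * ((a - b) / 2) := mul_nonneg hA0 (by linarith)
  have ha0 : 0 < a := by linarith
  have hb0 : 0 < b := by linarith
  simp only [G, B] at hG
  -- A positive maximum cannot lie at maturity, where `L s ≤ A s/2`; nor on the diagonal, where `v`
  -- cancels; nor on the outer sides, where the quadratic term already equals `2M`.
  have htT : t₀ < T := by
    refine lt_of_le_of_ne ht₀.2 fun he => ?_
    rw [he, hv.terminal a ha0, hv.terminal b hb0] at hG
    have h1 := hh.dist_le_mul a ha0 b hb0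
    rw [Real.dist_eq, Real.dist_eq, abs_of_nonneg (sub_nonneg.2 hba)] at h1
    have h2 := (le_abs_self _).trans h1
    have h3 := mul_le_mul_of_nonneg_right hAL (sub_nonneg.2 hba)
    have h4 : 0 ≤ K * ((a - c) ^ 2 + (b - c) ^ 2) := by positivity
    linarith
  have hba' : b < a := by
    refine lt_of_le_of_ne hba fun he => ?_
    have h4 : 0 ≤ K * ((a - c) ^ 2 + (b - c) ^ 2) := by positivity
    rw [he] at hG h4
    simp only [sub_self] at hG
    linarith
  have ha' : a < 3 * c / 2 := by
    refine lt_of_le_of_ne ha fun he => ?_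
    have h4 : 0 ≤ K * (b - c) ^ 2 := by positivity
    have h5 : K * (a - c) ^ 2 = 2 * M := by rw [he]; linarith
    linarith
  have hb' : c / 2 < b := by
    refine lt_of_le_of_ne hb fun he => ?_
    have h4 : 0 ≤ K * (a - c) ^ 2 := by positivity
    have h5 : K * (b - c) ^ 2 = 2 * M := by rw [← he]; linarith
    linarith
  have ht' : t₀ ∈ Ico 0 T := ⟨ht₀.1, htT⟩
  have hpt : derivWithin (fun s => v s a) (Icc 0 T) t₀
      - derivWithin (fun s => v s b) (Icc 0 T) t₀ ≤ 0 := by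
    refine (((hv.diff_t t₀ ht' a ha0).hasDerivWithinAt.sub
      (hv.diff_t t₀ ht' b hb0).hasDerivWithinAt)).nonpos_of_forall_le ht' fun s hs => ?_
    have := hGle (s, a, b) ⟨hs, hb, hba, ha⟩
    simp only [G] at this
    simp only [Pi.sub_apply]
    linarith
  have hxa : deriv (v t₀) a = 2 * K * (a - c) + A * (1 - 2 * k * (a - b)) ∧
      deriv (deriv (v t₀)) a ≤ 2 * (K - A * k) := by
    refine deriv_eq_and_deriv_deriv_le_of_isLocalMax_sub ?_ (hv.diff_xx t₀ ht' a ha0) ?_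
    · filter_upwards [Ioi_mem_nhds ha0] with x hx using hv.diff_x t₀ ht' x hx
    · filter_upwards [Ioo_mem_nhds hba' ha'] with x hx
      have := hGle (t₀, x, b) ⟨ht₀, hb, hx.1.le, hx.2.le⟩
      simp only [G, B] at this
      linarith
  have hyb : deriv (fun y => -v t₀ y) b = 2 * K * (b - c) - A * (1 - 2 * k * (a - b)) ∧
      deriv (deriv (fun y => -v t₀ y)) b ≤ 2 * (K - A * k) := by
    have hn := hv.neg
    refine deriv_eq_and_deriv_deriv_le_of_isLocalMax_sub ?_ (hn.diff_xx t₀ ht' b hb0) ?_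
    · filter_upwards [Ioi_mem_nhds hb0] with x hx using hn.diff_x t₀ ht' x hx
    · filter_upwards [Ioo_mem_nhds hb' hba'] with y hy
      have := hGle (t₀, a, y) ⟨ht₀, hy.1.le, hy.2.le, ha⟩
      simp only [G, B] at this
      linarith
  -- Subtract the equation at `b` from the one at `a`. After dropping terms of favourable sign, what
  -- is left is at most `(a² + b²)(K(σ² + 2r) - A k σ²)`. This is negative by `hA`, because the
  -- concavity `-A k` outweighs the localising term, whereas the equations force `0`.
  obtain ⟨hx1, hx2⟩ := hxa
  obtain ⟨hy1, hy2⟩ := hyb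
  have hpa := hv.pde t₀ ht' a ha0
  have hpb := hv.neg.pde t₀ ht' b hb0
  rw [derivWithin.fun_neg] at hpb
  rw [hx1] at hpa
  rw [hy1] at hpb
  have e1 := mul_le_mul_of_nonneg_left hx2 (show 0 ≤ σ ^ 2 * a ^ 2 / 2 by positivity)
  have e2 := mul_le_mul_of_nonneg_left hy2 (show 0 ≤ σ ^ 2 * b ^ 2 / 2 by positivity)
  have e3 := mul_nonneg hr hG.le
  have e4 : K * (σ ^ 2 + 2 * r) < A * k * σ ^ 2 := by
    have : K * (σ ^ 2 + 2 * r) * (2 * c ^ 2) < A * k * σ ^ 2 * (2 * c ^ 2) := by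
      calc K * (σ ^ 2 + 2 * r) * (2 * c ^ 2) = 2 * (K * c ^ 2) * (σ ^ 2 + 2 * r) := by ring
        _ = 16 * M * (σ ^ 2 + 2 * r) := by rw [hKM]; ring
        _ < A * σ ^ 2 * c := hA
        _ = 2 * A * σ ^ 2 * c * (1 / 2) := by ring
        _ = _ := by rw [← hkc]; ring
    exact lt_of_mul_lt_mul_right this (by positivity)
  have e5 := mul_lt_mul_of_pos_right e4 (show 0 < a ^ 2 + b ^ 2 by positivity)
  have e6 : 0 ≤ r * K * (c * (a + b) * 2 + ((a - c) ^ 2 + (b - c) ^ 2)) := by positivity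
  have e7 : 0 ≤ r * A * k * (a - b) ^ 2 := by positivity
  linarith

/-- Take `y = c` in the barrier estimate and divide by `x - c`: the quadratic terms vanish as `x ↓
c` and only the slope `A` survives. -/
theorem deriv_le (hr : 0 ≤ r) (hσ : 0 < σ) {L : ℝ≥0}
    (hh : LipschitzOnWith L h (Ioi 0)) (hv : IsBlackScholesSolution T r σ h v) {c M A : ℝ}
    (hc : 0 < c) (hM : ∀ t ∈ Icc 0 T, ∀ x ∈ Icc (c / 2) (3 * c / 2), |v t x| ≤ M)
    (hAL : 2 * L ≤ A) (hA : 16 * M * (σ ^ 2 + 2 * r) < A * σ ^ 2 * c) {t : ℝ}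
    (ht : t ∈ Ico 0 T) : deriv (v t) c ≤ A := by
  have h1 : HasDerivWithinAt (v t) (deriv (v t) c) (Ioo c (3 * c / 2)) c :=
    (hv.diff_x t ht c hc).hasDerivAt.hasDerivWithinAt
  rw [hasDerivWithinAt_iff_tendsto_slope' (by simp)] at h1
  have hcc : c < 3 * c / 2 := by linarith
  have : (𝓝[Ioo c (3 * c / 2)] c).NeBot := by
    rw [nhdsWithin_Ioo_eq_nhdsGT hcc]; infer_instance
  have hlim : Tendsto (fun x => 8 * M / c ^ 2 * (x - c) + A) (𝓝[Ioo c (3 * c / 2)] c) (𝓝 A) := by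
    have h2 : Continuous fun x => 8 * M / c ^ 2 * (x - c) + A := by fun_prop
    have h3 := h2.tendsto c
    simp only [sub_self, mul_zero, zero_add] at h3
    exact h3.mono_left nhdsWithin_le_nhds
  refine le_of_tendsto_of_tendsto h1 hlim ?_
  filter_upwards [self_mem_nhdsWithin] with x hx
  have hpos : 0 < x - c := sub_pos.2 hx.1
  have hb := hv.sub_le_barrier hr hσ hh hc hM hAL hA ⟨ht.1, ht.2.le⟩
    (show c / 2 ≤ c by linarith) hx.1.le hx.2.le
  have hA0 : 0 ≤ A := le_trans (by positivity) hAL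
  have h5 : 0 ≤ A * ((x - c) ^ 2 / (2 * c)) := by positivity
  rw [slope_def_field, div_le_iff₀ hpos]
  linarith

theorem exists_abs_deriv_le (hr : 0 ≤ r) (hσ : 0 < σ) {L : ℝ≥0}
    (hh : LipschitzOnWith L h (Ioi 0)) (hv : IsBlackScholesSolution T r σ h v) {α β : ℝ}
    (hα : 0 < α) : ∃ A, ∀ t ∈ Ico 0 T, ∀ x ∈ Icc α β, |deriv (v t) x| ≤ A := by
  obtain ⟨M, hM⟩ := ((isCompact_Icc.prod isCompact_Icc :
    IsCompact (Icc 0 T ×ˢ Icc (α / 2) (3 * β / 2)))).exists_bound_of_continuousOn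
      (hv.cont.mono (prod_mono le_rfl fun x hx => show (0 : ℝ) < x by linarith [hx.1]))
  have hLip : LipschitzOnWith L (-h) (Ioi 0) := hh.neg
  -- The second term meets the barrier condition at every centre `x ≥ α` at once; the `+ 1` makes it
  -- strict.
  refine ⟨2 * L + (16 * |M| * (σ ^ 2 + 2 * r) + 1) / (σ ^ 2 * α), fun t ht x hx => ?_⟩
  have hx0 : 0 < x := hα.trans_le hx.1
  have hMx : ∀ s ∈ Icc 0 T, ∀ y ∈ Icc (x / 2) (3 * x / 2), |v s y| ≤ |M| := fun s hs y hy =>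
    (hM (s, y) ⟨hs, by linarith [hx.1, hy.1], by linarith [hx.2, hy.2]⟩).trans (le_abs_self _)
  have hAL : 2 * (L : ℝ) ≤ 2 * L + (16 * |M| * (σ ^ 2 + 2 * r) + 1) / (σ ^ 2 * α) :=
    le_add_of_nonneg_right (by positivity)
  have hA : 16 * |M| * (σ ^ 2 + 2 * r)
      < (2 * L + (16 * |M| * (σ ^ 2 + 2 * r) + 1) / (σ ^ 2 * α)) * σ ^ 2 * x := by
    have h1 : 16 * |M| * (σ ^ 2 + 2 * r) + 1
        = (16 * |M| * (σ ^ 2 + 2 * r) + 1) / (σ ^ 2 * α) * (σ ^ 2 * α) := by field_simp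
    have h2 := mul_le_mul_of_nonneg_left (mul_le_mul_of_nonneg_left hx.1 (sq_nonneg σ))
      (show 0 ≤ (16 * |M| * (σ ^ 2 + 2 * r) + 1) / (σ ^ 2 * α) by positivity)
    have h3 : 0 ≤ 2 * (L : ℝ) * (σ ^ 2 * x) := by positivity
    linarith
  rw [abs_le]
  constructor
  · have := hv.neg.deriv_le hr hσ hLip hx0 (by simpa only [abs_neg] using hMx) hAL hA ht
    rw [deriv.fun_neg] at this
    linarith
  · exact hv.deriv_le hr hσ hh hx0 hMx hAL hA ht

end IsBlackScholesSolution

/-! ### Weighted squared increments up to time `t` -/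

theorem integral_discreteQV {T : ℝ} (τ : PartitionSeq T) (z : ℝ → ℝ) (n : ℕ) (f : ℝ →ᵇ ℝ) :
    ∫ s, f s ∂(discreteQV τ z n)
      = ∑ i ∈ Finset.range (τ.K n), f (τ.pt n i) * (z (τ.pt n (i + 1)) - z (τ.pt n i)) ^ 2 := by
  rw [discreteQV, integral_finsetSum_measure]
  · refine Finset.sum_congr rfl fun i _ => ?_
    rw [integral_smul_measure, integral_dirac, ENNReal.toReal_ofReal (sq_nonneg _), smul_eq_mul,
      mul_comm]
  · exact fun i _ => (integrable_dirac (by simp)).smul_measure ENNReal.ofReal_ne_top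

theorem eq_restrict_volume {T : ℝ} (hT : 0 ≤ T) {ξ : Measure ℝ} [IsFiniteMeasure ξ]
    (hc : ξ (Icc 0 T)ᶜ = 0) (h : ∀ t ∈ Icc (0 : ℝ) T, ξ (Icc 0 t) = ENNReal.ofReal t) :
    ξ = volume.restrict (Icc 0 T) := by
  refine Measure.ext_of_Iic _ _ fun a => ?_
  have h1 : ξ (Iic a) = ξ (Iic a ∩ Icc 0 T) := (measure_inter_conull hc).symm
  rw [h1, Measure.restrict_apply measurableSet_Iic]
  have h2 : Iic a ∩ Icc 0 T = Icc 0 (min a T) := by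
    ext s; simp only [mem_inter_iff, mem_Iic, mem_Icc, le_min_iff]; tauto
  rw [h2]
  rcases lt_or_ge a 0 with ha | ha
  · rw [Icc_eq_empty (by simp [ha])]; simp
  · rw [h _ ⟨le_min ha hT, min_le_right _ _⟩, Real.volume_Icc, sub_zero]

theorem tendsto_sum_sq_increments {T : ℝ} (hT : 0 ≤ T) {τ : PartitionSeq T} {z : ℝ → ℝ}
    (hz : z ∈ unitQVPaths τ) (f : ℝ →ᵇ ℝ) :
    Tendsto (fun n => ∑ i ∈ Finset.range (τ.K n),
      f (τ.pt n i) * (z (τ.pt n (i + 1)) - z (τ.pt n i)) ^ 2) atTop (𝓝 (∫ s in (0 : ℝ)..T, f s)) := by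
  obtain ⟨-, -, ξ, hξ, hd⟩ := hz
  have := hξ.finite
  have h := hξ.weak_limit f
  rw [eq_restrict_volume hT hξ.carried hd] at h
  simpa only [integral_discreteQV, intervalIntegral.integral_of_le hT,
    integral_Icc_eq_integral_Ioc] using h

/-- The continuous function that is `1` up to `a - δ`, `0` from `a` on, and affine in between. -/
noncomputable def ramp (a δ : ℝ) : ℝ →ᵇ ℝ :=
  BoundedContinuousFunction.ofNormedAddCommGroup (fun s => max 0 (min 1 ((a - s) / δ)))
    (by fun_prop) 1 (fun s => by
      rw [Real.norm_of_nonneg (le_max_left _ _)]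
      exact max_le zero_le_one (min_le_left _ _))

theorem ramp_apply (a δ s : ℝ) : ramp a δ s = max 0 (min 1 ((a - s) / δ)) := rfl

theorem ramp_nonneg (a δ s : ℝ) : 0 ≤ ramp a δ s := le_max_left _ _

theorem ramp_le_one (a δ s : ℝ) : ramp a δ s ≤ 1 := max_le zero_le_one (min_le_left _ _)

theorem ramp_eq_one {a δ s : ℝ} (hδ : 0 < δ) (h : s ≤ a - δ) : ramp a δ s = 1 := by
  have : 1 ≤ (a - s) / δ := by rw [le_div_iff₀ hδ]; linarith
  rw [ramp_apply, min_eq_left this, max_eq_right zero_le_one]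

theorem ramp_eq_zero {a δ s : ℝ} (hδ : 0 < δ) (h : a ≤ s) : ramp a δ s = 0 := by
  have : (a - s) / δ ≤ 0 := div_nonpos_of_nonpos_of_nonneg (by linarith) hδ.le
  rw [ramp_apply, max_eq_left ((min_le_right _ _).trans this)]

/-- The error of smoothing the cut-off at `t` is dominated by a continuous function, so weak
convergence controls the error too. -/
theorem abs_ramp_sub_indicator_le {t δ : ℝ} (hδ : 0 < δ) (s : ℝ) :
    |ramp (t + δ) δ s - (if s ≤ t then 1 else 0)| ≤ ramp (t + δ) δ s - ramp t δ s := by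
  split_ifs with hs
  · rw [ramp_eq_one hδ (show s ≤ t + δ - δ by linarith)]
    simpa using ramp_le_one t δ s
  · rw [ramp_eq_zero (a := t) hδ (by linarith), sub_zero,
      abs_of_nonneg (ramp_nonneg _ _ _)]

theorem integral_ramp_sub_ramp_le {t δ T : ℝ} (hδ : 0 < δ) (hT : 0 ≤ T) :
    ∫ s in (0 : ℝ)..T, (ramp (t + δ) δ s - ramp t δ s) ≤ 2 * δ := by
  have hle : ∀ s, ramp (t + δ) δ s - ramp t δ s ≤ (Ioc (t - δ) (t + δ)).indicator (fun _ => 1) s := by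
    intro s
    by_cases hs : s ∈ Ioc (t - δ) (t + δ)
    · rw [indicator_of_mem hs]; linarith [ramp_le_one (t + δ) δ s, ramp_nonneg t δ s]
    · rw [indicator_of_notMem hs]
      rw [mem_Ioc, not_and_or, not_lt, not_le] at hs
      rcases hs with hs | hs
      · rw [ramp_eq_one hδ hs, ramp_eq_one hδ (by linarith)]; simp
      · rw [ramp_eq_zero hδ hs.le]; linarith [ramp_nonneg t δ s]
  have hint : Integrable ((Ioc (t - δ) (t + δ)).indicator (fun _ => (1 : ℝ))) :=
    (integrable_indicator_iff measurableSet_Ioc).2 (integrableOn_const (by simp))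
  rw [intervalIntegral.integral_of_le hT]
  calc ∫ s in Ioc 0 T, (ramp (t + δ) δ s - ramp t δ s)
      ≤ ∫ s in Ioc 0 T, (Ioc (t - δ) (t + δ)).indicator (fun _ => (1 : ℝ)) s := by
        refine integral_mono ?_ hint.integrableOn hle
        exact (((ramp (t + δ) δ).continuous.sub (ramp t δ).continuous).integrableOn_Icc
          (a := 0) (b := T)).mono_set Ioc_subset_Icc_self
    _ ≤ ∫ s, (Ioc (t - δ) (t + δ)).indicator (fun _ => (1 : ℝ)) s :=
        setIntegral_le_integral hint (ae_of_all _ fun s => indicator_nonneg (by simp) s)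
    _ = 2 * δ := by
        rw [integral_indicator measurableSet_Ioc]
        simp [Measure.real, Real.volume_Ioc]
        rw [ENNReal.toReal_ofReal (by linarith)]; ring

/-- The cut-off is discontinuous, but the limit measure is Lebesgue and has no atom at `t`: the gap
between two ramps around `t` has integral at most `2δ`. -/
theorem tendsto_sum_filter_sq_increments_of_bounded {T t : ℝ} (ht : t ∈ Icc 0 T)
    {τ : PartitionSeq T} {z : ℝ → ℝ} (hz : z ∈ unitQVPaths τ) (f : ℝ →ᵇ ℝ) :
    Tendsto (fun n => ∑ i ∈ (Finset.range (τ.K n)).filter (fun i => τ.pt n i ≤ t),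
      f (τ.pt n i) * (z (τ.pt n (i + 1)) - z (τ.pt n i)) ^ 2) atTop (𝓝 (∫ s in (0 : ℝ)..t, f s)) := by
  have hT : 0 ≤ T := ht.1.trans ht.2
  rw [Metric.tendsto_atTop']
  intro ε hε
  set C := ‖f‖ + 1 with hC
  have hC0 : 0 < C := by positivity
  have hfC : ∀ s, |f s| ≤ C := fun s => (f.norm_coe_le_norm s).trans (by linarith)
  -- Error budget: `ε/2` for the smoothed sum against the cut-off sum, `ε/4` for convergence, `ε/4`
  -- for the smoothed integral.
  obtain ⟨δ, hδ, hδε⟩ : ∃ δ > 0, C * (2 * δ) = ε / 4 :=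
    ⟨ε / (8 * C), by positivity, by field_simp; norm_num⟩
  have h1 := tendsto_sum_sq_increments hT hz (f * ramp (t + δ) δ)
  have h2 := tendsto_sum_sq_increments hT hz (ramp (t + δ) δ - ramp t δ)
  have h1' := (Metric.tendsto_nhds.1 h1) (ε / 4) (by positivity)
  have h2' := (h2.const_mul C).eventually_lt_const (u := ε / 2) (by
    have := mul_le_mul_of_nonneg_left (integral_ramp_sub_ramp_le (t := t) hδ hT) hC0.le
    refine lt_of_le_of_lt (b := C * (2 * δ)) this ?_
    linarith)
  have h3 : |(∫ s in (0 : ℝ)..T, (f * ramp (t + δ) δ) s) - ∫ s in (0 : ℝ)..t, f s| ≤ ε / 4 := by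
    have hi : ∫ s in (0 : ℝ)..t, f s = ∫ s in (0 : ℝ)..T, f s * (if s ≤ t then 1 else 0) := by
      rw [intervalIntegral.integral_of_le ht.1, intervalIntegral.integral_of_le hT]
      have : (fun s => f s * (if s ≤ t then 1 else 0)) = (Iic t).indicator f := by
        ext s; simp [indicator_apply]
      rw [this, setIntegral_indicator measurableSet_Iic]
      congr 2
      ext s; simp only [mem_inter_iff, mem_Ioc, mem_Iic]
      exact ⟨fun h => ⟨⟨h.1, h.2.trans ht.2⟩, h.2⟩, fun h => ⟨h.1.1, h.2⟩⟩
    have hint1 : IntervalIntegrable (fun s => (f * ramp (t + δ) δ) s) volume 0 T :=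
      (f * ramp (t + δ) δ).continuous.intervalIntegrable _ _
    have hint2 : IntervalIntegrable (fun s => f s * (if s ≤ t then (1 : ℝ) else 0)) volume 0 T := by
      have : (fun s => f s * (if s ≤ t then (1 : ℝ) else 0)) = (Iic t).indicator f := by
        ext s; simp [indicator_apply]
      rw [this, intervalIntegrable_iff]
      exact ((intervalIntegrable_iff.1 (f.continuous.intervalIntegrable 0 T)).indicator
        measurableSet_Iic)
    rw [hi, ← intervalIntegral.integral_sub hint1 hint2, ← Real.norm_eq_abs]
    refine (intervalIntegral.norm_integral_le_of_norm_le
      (g := fun s => C * (ramp (t + δ) δ s - ramp t δ s)) hT (ae_of_all _ fun s _ => ?_) ?_).trans ?_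
    · rw [BoundedContinuousFunction.mul_apply, ← mul_sub, norm_mul]
      exact mul_le_mul (hfC s) (abs_ramp_sub_indicator_le hδ s) (norm_nonneg _) hC0.le
    · exact (continuous_const.mul
        ((ramp (t + δ) δ).continuous.sub (ramp t δ).continuous)).intervalIntegrable _ _
    · rw [intervalIntegral.integral_const_mul, ← hδε]
      exact mul_le_mul_of_nonneg_left (integral_ramp_sub_ramp_le hδ hT) hC0.le
  obtain ⟨N, hN⟩ := eventually_atTop.1 (h1'.and h2')
  refine ⟨N, fun n hn => ?_⟩
  obtain ⟨hn1, hn2⟩ := hN n hn.le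
  rw [Real.dist_eq] at hn1 ⊢
  rw [Finset.sum_filter]
  have h4 : |(∑ i ∈ Finset.range (τ.K n), if τ.pt n i ≤ t then
        f (τ.pt n i) * (z (τ.pt n (i + 1)) - z (τ.pt n i)) ^ 2 else 0)
      - ∑ i ∈ Finset.range (τ.K n), (f * ramp (t + δ) δ) (τ.pt n i)
          * (z (τ.pt n (i + 1)) - z (τ.pt n i)) ^ 2|
      ≤ C * ∑ i ∈ Finset.range (τ.K n), (ramp (t + δ) δ - ramp t δ) (τ.pt n i)
          * (z (τ.pt n (i + 1)) - z (τ.pt n i)) ^ 2 := by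
    rw [← Finset.sum_sub_distrib, Finset.mul_sum]
    refine (Finset.abs_sum_le_sum_abs _ _).trans (Finset.sum_le_sum fun i _ => ?_)
    set s := τ.pt n i
    set w := (z (τ.pt n (i + 1)) - z s) ^ 2 with hw
    have hw0 : 0 ≤ w := sq_nonneg _
    have e : (if s ≤ t then f s * w else 0) - (f * ramp (t + δ) δ) s * w
        = -(f s * (ramp (t + δ) δ s - if s ≤ t then 1 else 0)) * w := by
      rw [BoundedContinuousFunction.mul_apply]; split_ifs <;> ring
    rw [e, abs_mul, abs_neg, abs_mul, abs_of_nonneg hw0, ← mul_assoc]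
    exact mul_le_mul_of_nonneg_right
      (mul_le_mul (hfC s) (abs_ramp_sub_indicator_le hδ s) (abs_nonneg _) hC0.le) hw0
  rw [abs_le] at h3 h4
  rw [abs_lt] at hn1 ⊢
  constructor <;> linarith [h3.1, h3.2, h4.1, h4.2, hn1.1, hn1.2]

/-- Extending `g` by constants outside `[0, t]` makes it bounded and continuous without changing any
term. -/
theorem tendsto_sum_filter_sq_increments {T t : ℝ} (ht : t ∈ Icc 0 T)
    {τ : PartitionSeq T} {z : ℝ → ℝ} (hz : z ∈ unitQVPaths τ) {g : ℝ → ℝ}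
    (hg : ContinuousOn g (Icc 0 t)) (hpos : ∀ n, ∀ i < τ.K n, 0 ≤ τ.pt n i) :
    Tendsto (fun n => ∑ i ∈ (Finset.range (τ.K n)).filter (fun i => τ.pt n i ≤ t),
      g (τ.pt n i) * (z (τ.pt n (i + 1)) - z (τ.pt n i)) ^ 2) atTop (𝓝 (∫ s in (0 : ℝ)..t, g s)) := by
  obtain ⟨C, hC⟩ := isCompact_Icc.exists_bound_of_continuousOn hg
  let f : ℝ →ᵇ ℝ := BoundedContinuousFunction.ofNormedAddCommGroup
    (IccExtend ht.1 ((Icc 0 t).domRestrict g)) hg.domRestrict.Icc_extend' C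
    (fun s => hC _ (projIcc 0 t ht.1 s).2)
  have hf : ∀ s ∈ Icc 0 t, f s = g s := fun s hs => IccExtend_of_mem ht.1 ((Icc 0 t).domRestrict g) hs
  have h := tendsto_sum_filter_sq_increments_of_bounded ht hz f
  have e : ∫ s in (0 : ℝ)..t, f s = ∫ s in (0 : ℝ)..t, g s :=
    intervalIntegral.integral_congr fun s hs => hf s (by rwa [uIcc_of_le ht.1] at hs)
  rw [e] at h
  refine h.congr fun n => Finset.sum_congr rfl fun i hi => ?_
  rw [Finset.mem_filter, Finset.mem_range] at hi
  rw [hf _ ⟨hpos n i hi.1, hi.2⟩]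

/-! ### Second-order expansion on a partition interval -/

/-- The mean value inequality is applied twice, first to `f'` and then to `f`, each time with the
quadratic model subtracted. -/
theorem abs_taylor_two_sub_le {f : ℝ → ℝ} {a b q ε : ℝ}
    (hf : ∀ y ∈ uIcc a b, DifferentiableAt ℝ f y)
    (hf' : ∀ y ∈ uIcc a b, DifferentiableAt ℝ (deriv f) y)
    (hq : ∀ y ∈ uIcc a b, |deriv (deriv f) y - q| ≤ ε) :
    |f b - f a - deriv f a * (b - a) - q / 2 * (b - a) ^ 2| ≤ ε * (b - a) ^ 2 := by
  have ha : a ∈ uIcc a b := left_mem_uIcc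
  have h1 : ∀ y ∈ uIcc a b, |deriv f y - deriv f a - q * (y - a)| ≤ ε * |b - a| := by
    intro y hy
    have h := (convex_uIcc a b).norm_image_sub_le_of_norm_hasDerivWithin_le
      (f := fun y => deriv f y - q * y) (f' := fun y => deriv (deriv f) y - q) (C := ε)
      (fun y hy => ((hf' y hy).hasDerivAt.sub
        (by simpa using (hasDerivAt_id y).const_mul q)).hasDerivWithinAt) hq ha hy
    have h2 : |y - a| ≤ |b - a| := abs_sub_left_of_mem_uIcc hy
    have hε : 0 ≤ ε := (abs_nonneg _).trans (hq a ha)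
    refine le_trans (le_of_eq ?_) (h.trans (mul_le_mul_of_nonneg_left h2 hε))
    rw [Real.norm_eq_abs]; congr 1; ring
  have h := (convex_uIcc a b).norm_image_sub_le_of_norm_hasDerivWithin_le
      (f := fun y => f y - (deriv f a * (y - a) + q / 2 * (y - a) ^ 2))
      (f' := fun y => deriv f y - (deriv f a + q * (y - a))) (C := ε * |b - a|)
      (fun y hy => ?_) (fun y hy => ?_) ha (right_mem_uIcc)
  · rw [Real.norm_eq_abs, Real.norm_eq_abs, mul_assoc, abs_mul_abs_self] at h
    refine le_trans (le_of_eq ?_) (h.trans (le_of_eq (by ring)))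
    congr 1; ring
  · have h2 : HasDerivAt (fun y => y - a) 1 y := (hasDerivAt_id y).sub_const a
    have h3 := (h2.const_mul (deriv f a)).fun_add ((h2.pow 2).const_mul (q / 2))
    refine ((hf y hy).hasDerivAt.fun_sub (h3.congr_deriv ?_)).hasDerivWithinAt
    norm_num; ring
  · rw [Real.norm_eq_abs, ← sub_sub]; exact h1 y hy

theorem abs_sq_exp_sub_one_sub_sq_le {w : ℝ} (hw : |w| ≤ 1) :
    |(Real.exp w - 1) ^ 2 - w ^ 2| ≤ 3 * |w| * w ^ 2 := by
  have h1 := Real.abs_exp_sub_one_sub_id_le hw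
  have h2 : |Real.exp w - 1 + w| ≤ 3 * |w| := by
    have := abs_add_le (Real.exp w - 1) w
    linarith [Real.abs_exp_sub_one_le hw]
  have e : (Real.exp w - 1) ^ 2 - w ^ 2 = (Real.exp w - 1 - w) * (Real.exp w - 1 + w) := by ring
  rw [e, abs_mul, mul_comm]
  exact mul_le_mul h2 h1 (abs_nonneg _) (by positivity)

theorem uniformContinuousOn_Icc_real {f : ℝ → ℝ} {a b : ℝ} (hf : ContinuousOn f (Icc a b))
    {ε : ℝ} (hε : 0 < ε) :
    ∃ δ > 0, ∀ s ∈ Icc a b, ∀ s' ∈ Icc a b, |s - s'| < δ → |f s - f s'| < ε := by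
  obtain ⟨δ, hδ, h⟩ := Metric.uniformContinuousOn_iff.1
    (isCompact_Icc.uniformContinuousOn_of_continuous hf) ε hε
  exact ⟨δ, hδ, fun s hs s' hs' hss => h s hs s' hs' hss⟩

namespace IsBlackScholesSolution

variable {T r σ : ℝ} {h : ℝ → ℝ} {v : ℝ → ℝ → ℝ}

theorem continuousOn_comp_path {g : ℝ × ℝ → ℝ} {x : ℝ → ℝ} {S S' : Set ℝ}
    (hg : ContinuousOn g (S ×ˢ Ioi 0)) (hx : ContinuousOn x S') (hSS : S' ⊆ S)
    (hpos : ∀ s ∈ S', 0 < x s) : ContinuousOn (fun s => g (s, x s)) S' :=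
  hg.comp (continuousOn_id.prodMk hx) fun s hs => ⟨hSS hs, hpos s hs⟩

/-- Second order expansion of `v` along an exponential path, uniformly in the base point. -/
theorem local_expansion (hv : IsBlackScholesSolution T r σ h v) (hσ : 0 < σ) {x₀ u : ℝ}
    (hx₀ : 0 < x₀) (hu : u < T) {x z : ℝ → ℝ} (hz : ContinuousOn z (Icc 0 u))
    (hx : ∀ t ∈ Icc 0 u, x t = x₀ * Real.exp (σ * z t)) {ε : ℝ} (hε : 0 < ε) :
    ∃ δ > 0, ∀ s s', 0 ≤ s → s < s' → s' ≤ u → s' - s < δ →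
      |v s' (x s') - v s (x s)
        - (∫ θ in s..s', derivWithin (fun t => v t (x θ)) (Icc 0 T) θ)
        - deriv (v s) (x s) * (x s' - x s)
        - σ ^ 2 * x s ^ 2 / 2 * deriv (deriv (v s)) (x s) * (z s' - z s) ^ 2|
      ≤ ε * ((s' - s) + (z s' - z s) ^ 2) := by
  have hxpos : ∀ t ∈ Icc 0 u, 0 < x t := fun t ht => by rw [hx t ht]; positivity
  have hxc : ContinuousOn x (Icc 0 u) :=
    ContinuousOn.congr (by fun_prop) hx
  have hIu : Icc 0 u ⊆ Ico 0 T := fun s hs => ⟨hs.1, hs.2.trans_lt hu⟩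
  rcases lt_or_ge u 0 with hu0 | hu0
  · exact ⟨1, one_pos, fun s s' h1 h2 h3 => by linarith⟩
  have hne : (Icc 0 u).Nonempty := ⟨0, le_rfl, hu0⟩
  obtain ⟨p, hp, hpmin⟩ := isCompact_Icc.exists_isMinOn hne hxc
  obtain ⟨q, hq, hqmax⟩ := isCompact_Icc.exists_isMaxOn hne hxc
  set α := x p
  set β := x q
  have hα : 0 < α := hxpos p hp
  have hβ : 0 < β := hxpos q hq
  have hxI : ∀ s ∈ Icc 0 u, x s ∈ Icc α β := fun s hs => ⟨hpmin hs, hqmax hs⟩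
  have hsub : Icc 0 u ×ˢ Icc α β ⊆ Ico 0 T ×ˢ Ioi 0 :=
    prod_mono hIu fun y hy => hα.trans_le hy.1
  have hQ : IsCompact (Icc 0 u ×ˢ Icc α β) := isCompact_Icc.prod isCompact_Icc
  obtain ⟨C, hC⟩ := hQ.exists_bound_of_continuousOn (hv.cont_xx.mono hsub)
  have hC0 : 0 ≤ C := (norm_nonneg _).trans (hC (p, x p) ⟨hp, hxI p hp⟩)
  -- Absorbs the constant in `(Δx)² ≤ 4 β² σ² (Δz)²`.
  set ε₁ := ε / (2 * (4 * β ^ 2 * σ ^ 2 + 1)) with hε₁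
  have hε₁0 : 0 < ε₁ := by positivity
  obtain ⟨δ₁, hδ₁, ht⟩ := Metric.uniformContinuousOn_iff.1
    (hQ.uniformContinuousOn_of_continuous (hv.cont_t.mono hsub)) ε hε
  obtain ⟨δ₂, hδ₂, hxx⟩ := Metric.uniformContinuousOn_iff.1
    (hQ.uniformContinuousOn_of_continuous (hv.cont_xx.mono hsub)) ε₁ hε₁0
  obtain ⟨δ₃, hδ₃, hxu⟩ := uniformContinuousOn_Icc_real hxc (lt_min hδ₁ hδ₂)
  -- The first bound gives `|σ Δz| ≤ 1`; the second makes the cubic error of `(exp w - 1)² ≈ w²` at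
  -- most `(ε/2)(Δz)²`.
  set η := min (1 / σ) (ε / (3 * β ^ 2 * σ ^ 3 * (C + 1))) with hη
  have hη0 : 0 < η := by positivity
  obtain ⟨δ₄, hδ₄, hzu⟩ := uniformContinuousOn_Icc_real hz hη0
  refine ⟨min δ₁ (min δ₃ δ₄), by positivity, fun s s' hs hss hs' hd => ?_⟩
  obtain ⟨hd₁, hd₂⟩ := lt_min_iff.1 hd
  obtain ⟨hd₃, hd₄⟩ := lt_min_iff.1 hd₂
  have ms : s ∈ Icc 0 u := ⟨hs, hss.le.trans hs'⟩
  have ms' : s' ∈ Icc 0 u := ⟨hs.trans hss.le, hs'⟩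
  have hsT := hIu ms
  have habs : |s' - s| = s' - s := abs_of_pos (sub_pos.2 hss)
  -- the time increment
  have htime : |v s' (x s') - v s (x s')
      - ∫ θ in s..s', derivWithin (fun t => v t (x θ)) (Icc 0 T) θ| ≤ ε * (s' - s) := by
    have hIs : Icc s s' ⊆ Icc 0 u := Icc_subset_Icc hs hs'
    have hdt : ∀ t ∈ Icc 0 u, HasDerivWithinAt (fun t => v t (x s'))
        (derivWithin (fun t => v t (x s')) (Icc 0 T) t) (Icc 0 T) t := fun t ht =>
      (hv.diff_t t (hIu ht) _ (hxpos s' ms')).hasDerivWithinAt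
    -- Time moves with the price frozen at `x s'`. Uniform continuity then compares the intermediate
    -- value of `v_t` with its values along the path.
    obtain ⟨c, hc, hceq⟩ := exists_hasDerivAt_eq_slope (fun t => v t (x s'))
      (fun t => derivWithin (fun t => v t (x s')) (Icc 0 T) t) hss
      (fun t ht => (hdt t (hIs ht)).continuousWithinAt.mono
        fun y hy => ⟨hs.trans hy.1, hy.2.trans (hs'.trans hu.le)⟩)
      (fun t ht => (hdt t (hIs ⟨ht.1.le, ht.2.le⟩)).hasDerivAt
        (Icc_mem_nhds (hs.trans_lt ht.1) (ht.2.trans_le (hs'.trans hu.le))))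
    have hc' : c ∈ Icc 0 u := hIs ⟨hc.1.le, hc.2.le⟩
    have hint : IntervalIntegrable (fun θ => derivWithin (fun t => v t (x θ)) (Icc 0 T) θ)
        volume s s' := by
      refine ContinuousOn.intervalIntegrable ?_
      rw [uIcc_of_le hss.le]
      exact continuousOn_comp_path hv.cont_t (hxc.mono hIs) (hIs.trans hIu)
        fun t ht => hxpos t (hIs ht)
    have e : v s' (x s') - v s (x s')
        = ∫ _ in s..s', derivWithin (fun t => v t (x s')) (Icc 0 T) c := by
      rw [intervalIntegral.integral_const, smul_eq_mul, hceq]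
      field_simp [(sub_pos.2 hss).ne']
    rw [e, ← intervalIntegral.integral_sub intervalIntegrable_const hint, ← habs,
      ← Real.norm_eq_abs]
    refine intervalIntegral.norm_integral_le_of_norm_le_const fun θ hθ => ?_
    rw [uIoc_of_le hss.le] at hθ
    have mθ : θ ∈ Icc 0 u := hIs ⟨hθ.1.le, hθ.2⟩
    refine (ht (c, x s') ⟨hc', hxI s' ms'⟩ (θ, x θ) ⟨mθ, hxI θ mθ⟩ ?_).le
    rw [Prod.dist_eq, max_lt_iff, Real.dist_eq, Real.dist_eq]
    constructor
    · rw [abs_lt]; constructor <;> linarith [hθ.1, hθ.2, hc.1, hc.2]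
    · refine (hxu s' ms' θ mθ ?_).trans_le (min_le_left _ _)
      rw [abs_of_nonneg (by linarith [hθ.2])]; linarith [hθ.1]
  -- the space increment
  have hseg : ∀ y ∈ uIcc (x s) (x s'), y ∈ Icc α β :=
    fun y hy => uIcc_subset_Icc (hxI s ms) (hxI s' ms') hy
  have hspace := abs_taylor_two_sub_le (f := v s) (a := x s) (b := x s')
    (q := deriv (deriv (v s)) (x s)) (ε := ε₁)
    (fun y hy => hv.diff_x s hsT y (hα.trans_le (hseg y hy).1))
    (fun y hy => hv.diff_xx s hsT y (hα.trans_le (hseg y hy).1)) (fun y hy => by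
      refine (hxx (s, y) ⟨ms, hseg y hy⟩ (s, x s) ⟨ms, hxI s ms⟩ ?_).le
      rw [Prod.dist_eq, max_lt_iff, Real.dist_eq, Real.dist_eq]
      refine ⟨by simpa using hδ₂, ?_⟩
      refine (abs_sub_left_of_mem_uIcc hy).trans_lt
        ((hxu s' ms' s ms ?_).trans_le (min_le_right _ _))
      rwa [habs])
  -- comparison of the squared increments of `x` and `z`
  have hzz : |z s' - z s| < η := hzu s' ms' s ms (by rwa [habs])
  set w := σ * (z s' - z s) with hw
  have hw2 : w ^ 2 = σ ^ 2 * (z s' - z s) ^ 2 := by rw [hw]; ring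
  have hwabs : |w| = σ * |z s' - z s| := by rw [hw, abs_mul, abs_of_pos hσ]
  have hw1 : |w| ≤ 1 := by
    rw [hwabs]
    have := mul_le_mul_of_nonneg_left (hzz.le.trans (min_le_left _ _)) hσ.le
    rwa [mul_one_div_cancel hσ.ne'] at this
  have hinc : x s' - x s = x s * (Real.exp w - 1) := by
    rw [hx s ms, hx s' ms', hw, mul_sub σ, Real.exp_sub]
    field_simp
  have hxsβ : x s ^ 2 ≤ β ^ 2 := pow_le_pow_left₀ (hxpos s ms).le (hxI s ms).2 2
  have hsq : (x s' - x s) ^ 2 ≤ 4 * β ^ 2 * σ ^ 2 * (z s' - z s) ^ 2 := by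
    rw [hinc, mul_pow]
    have h1 : (Real.exp w - 1) ^ 2 ≤ (2 * |w|) ^ 2 := by
      rw [← sq_abs (Real.exp w - 1)]
      exact pow_le_pow_left₀ (abs_nonneg _) (Real.abs_exp_sub_one_le hw1) 2
    calc x s ^ 2 * (Real.exp w - 1) ^ 2 ≤ β ^ 2 * (2 * |w|) ^ 2 :=
          mul_le_mul hxsβ h1 (sq_nonneg _) (sq_nonneg _)
      _ = _ := by rw [mul_pow, sq_abs, hw2]; ring
  have hcmp : |deriv (deriv (v s)) (x s) / 2 * (x s' - x s) ^ 2
      - σ ^ 2 * x s ^ 2 / 2 * deriv (deriv (v s)) (x s) * (z s' - z s) ^ 2|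
      ≤ ε / 2 * (z s' - z s) ^ 2 := by
    have e : deriv (deriv (v s)) (x s) / 2 * (x s' - x s) ^ 2
        - σ ^ 2 * x s ^ 2 / 2 * deriv (deriv (v s)) (x s) * (z s' - z s) ^ 2
        = deriv (deriv (v s)) (x s) / 2 * (x s ^ 2 * ((Real.exp w - 1) ^ 2 - w ^ 2)) := by
      rw [hinc, hw2]; ring
    have h1 : |deriv (deriv (v s)) (x s) / 2| ≤ (C + 1) / 2 := by
      rw [abs_div, abs_two]
      have := hC (s, x s) ⟨ms, hxI s ms⟩
      rw [Real.norm_eq_abs] at this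
      linarith
    have h2 : 3 * β ^ 2 * σ ^ 3 * (C + 1) * |z s' - z s| ≤ ε := by
      have := mul_le_mul_of_nonneg_left (hzz.le.trans (min_le_right _ _))
        (show 0 ≤ 3 * β ^ 2 * σ ^ 3 * (C + 1) by positivity)
      rwa [mul_div_cancel₀ _ (by positivity)] at this
    rw [e, abs_mul, abs_mul, abs_of_nonneg (sq_nonneg (x s))]
    calc |deriv (deriv (v s)) (x s) / 2| * (x s ^ 2 * |(Real.exp w - 1) ^ 2 - w ^ 2|)
        ≤ (C + 1) / 2 * (β ^ 2 * (3 * |w| * w ^ 2)) := by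
          refine mul_le_mul h1 (mul_le_mul hxsβ (abs_sq_exp_sub_one_sub_sq_le hw1)
            (abs_nonneg _) (sq_nonneg _)) (by positivity) (by positivity)
      _ = (3 * β ^ 2 * σ ^ 3 * (C + 1) * |z s' - z s|) / 2 * (z s' - z s) ^ 2 := by
          rw [hwabs, hw2]; ring
      _ ≤ ε / 2 * (z s' - z s) ^ 2 :=
          mul_le_mul_of_nonneg_right (by linarith) (sq_nonneg _)
  have hspace' : ε₁ * (x s' - x s) ^ 2 ≤ ε / 2 * (z s' - z s) ^ 2 := by
    have h1 := mul_le_mul_of_nonneg_left hsq hε₁0.le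
    have h2 : ε₁ * (4 * β ^ 2 * σ ^ 2 + 1) = ε / 2 := by rw [hε₁]; field_simp
    have h3 : 0 ≤ ε₁ * (z s' - z s) ^ 2 := by positivity
    rw [← h2]
    linarith
  rw [abs_le] at htime hspace hcmp ⊢
  constructor <;> linarith [htime.1, htime.2, hspace.1, hspace.2, hcmp.1, hcmp.2]

end IsBlackScholesSolution

/-! ### Partition points up to a given time -/

namespace PartitionSeq

variable {T : ℝ} (τ : PartitionSeq T)

/-- The mesh of the `n`-th partition. -/
noncomputable def mesh (n : ℕ) : ℝ := ⨆ i : Fin (τ.K n), (τ.pt n (i + 1) - τ.pt n i)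

theorem sub_le_mesh {n i : ℕ} (hi : i < τ.K n) : τ.pt n (i + 1) - τ.pt n i ≤ τ.mesh n :=
  le_ciSup (f := fun i : Fin (τ.K n) => τ.pt n (i + 1) - τ.pt n i) (finite_range _).bddAbove ⟨i, hi⟩

theorem pt_le_pt {n i j : ℕ} (hij : i ≤ j) (hj : j ≤ τ.K n) : τ.pt n i ≤ τ.pt n j := by
  induction j, hij using Nat.le_induction with
  | base => exact le_rfl
  | succ k _ ih => exact (ih (by lia)).trans (τ.pt_lt n k (by lia)).le

theorem pt_nonneg {n i : ℕ} (hi : i ≤ τ.K n) : 0 ≤ τ.pt n i := by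
  simpa [τ.pt_zero] using τ.pt_le_pt (Nat.zero_le i) hi

/-- The points of the `n`-th partition up to `t` are an initial segment, and the point that follows
them is within the mesh from `t`. -/
theorem exists_filter_eq_range {t : ℝ} (ht : t ∈ Ico 0 T) (n : ℕ) :
    ∃ m ≤ τ.K n, (Finset.range (τ.K n)).filter (fun i => τ.pt n i ≤ t) = Finset.range m ∧
      t < τ.pt n m ∧ τ.pt n m ≤ t + τ.mesh n := by
  classical
  have hex : ∃ m, t < τ.pt n m := ⟨τ.K n, by rw [τ.pt_last]; exact ht.2⟩
  have hmK : Nat.find hex ≤ τ.K n := Nat.find_min' hex (by rw [τ.pt_last]; exact ht.2)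
  have hmin : ∀ i < Nat.find hex, τ.pt n i ≤ t := fun i hi => not_lt.1 (Nat.find_min hex hi)
  refine ⟨Nat.find hex, hmK, ?_, Nat.find_spec hex, ?_⟩
  · ext i
    rw [Finset.mem_filter, Finset.mem_range, Finset.mem_range]
    refine ⟨fun h => ?_, fun h => ⟨h.trans_le hmK, hmin i h⟩⟩
    by_contra! hi
    exact absurd (Nat.find_spec hex) (not_lt.2 ((τ.pt_le_pt hi h.1.le).trans h.2))
  · have hm0 : Nat.find hex ≠ 0 := fun h0 => by
      have := Nat.find_spec hex
      rw [h0, τ.pt_zero] at this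
      exact absurd ht.1 (not_le.2 this)
    obtain ⟨k, hk⟩ := Nat.exists_eq_succ_of_ne_zero hm0
    have h1 := hmin k (by lia)
    have h2 := τ.sub_le_mesh (n := n) (i := k) (by lia)
    rw [hk]
    simp only [Nat.succ_eq_add_one]
    linarith

end PartitionSeq

/-! ### Itô–Föllmer formula and integrability of the bond position -/

namespace IsBlackScholesSolution

variable {T r σ : ℝ} {h : ℝ → ℝ} {v : ℝ → ℝ → ℝ}

/-- The Itô–Föllmer formula for a solution of the Black–Scholes equation along a trajectory. -/
theorem tendsto_follmerSum (hv : IsBlackScholesSolution T r σ h v) (hσ : 0 < σ) {x₀ : ℝ}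
    (hx₀ : 0 < x₀) {τ : PartitionSeq T} {x : ℝ → ℝ} (hx : x ∈ trajectoryClass τ σ x₀) {t : ℝ}
    (ht : t ∈ Ico 0 T) :
    Tendsto (fun n => follmerSum τ (fun s => deriv (v s) (x s)) x t n) atTop
      (𝓝 (v t (x t) - v 0 (x 0) - ∫ s in (0 : ℝ)..t, (v s (x s) - deriv (v s) (x s) * x s) * r)) := by
  obtain ⟨z, hz, hxz⟩ := hx
  have hT : 0 ≤ T := ht.1.trans ht.2.le
  -- The last interval in the sum overshoots `t`; the margin up to `u < T` keeps its right end where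
  -- `v` is `C^{1,2}`.
  obtain ⟨u, htu, huT⟩ := exists_between ht.2
  have hu0 : 0 ≤ u := ht.1.trans htu.le
  have hIuT : Icc 0 u ⊆ Icc 0 T := Icc_subset_Icc_right huT.le
  have hIu : Icc 0 u ⊆ Ico 0 T := fun s hs => ⟨hs.1, hs.2.trans_lt huT⟩
  have hItu : Icc 0 t ⊆ Icc 0 u := Icc_subset_Icc_right htu.le
  have hzc : ContinuousOn z (Icc 0 u) := hz.1.mono hIuT
  have hxu : ∀ s ∈ Icc 0 u, x s = x₀ * Real.exp (σ * z s) := fun s hs => hxz s (hIuT hs)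
  have hxc : ContinuousOn x (Icc 0 u) := ContinuousOn.congr (by fun_prop) hxu
  have hxpos : ∀ s ∈ Icc 0 u, 0 < x s := fun s hs => by rw [hxu s hs]; positivity
  have hvc : ContinuousOn (fun s => v s (x s)) (Icc 0 u) :=
    continuousOn_comp_path hv.cont hxc hIuT hxpos
  have hvtc : ContinuousOn (fun s => derivWithin (fun t => v t (x s)) (Icc 0 T) s) (Icc 0 u) :=
    continuousOn_comp_path hv.cont_t hxc hIu hxpos
  have hvxxc : ContinuousOn (fun s => deriv (deriv (v s)) (x s)) (Icc 0 u) :=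
    continuousOn_comp_path hv.cont_xx hxc hIu hxpos
  have hgc : ContinuousOn (fun s => σ ^ 2 * x s ^ 2 / 2 * deriv (deriv (v s)) (x s)) (Icc 0 u) := by
    fun_prop
  choose m hmK hfilter hlt hle using τ.exists_filter_eq_range ht
  have hmesh : Tendsto τ.mesh atTop (𝓝 0) := τ.mesh_tendsto
  have htm : Tendsto (fun n => τ.pt n (m n)) atTop (𝓝 t) := by
    refine tendsto_of_tendsto_of_tendsto_of_le_of_le tendsto_const_nhds ?_
      (fun n => (hlt n).le) hle
    simpa using hmesh.const_add t
  have hev : ∀ᶠ n in atTop, τ.pt n (m n) ≤ u := htm.eventually_le_const htu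
  have htm' : Tendsto (fun n => τ.pt n (m n)) atTop (𝓝[Icc 0 u] t) :=
    tendsto_nhdsWithin_iff.2 ⟨htm, hev.mono fun n hn => ⟨τ.pt_nonneg (hmK n), hn⟩⟩
  have hmt : t ∈ Icc 0 u := ⟨ht.1, htu.le⟩
  have l1 := (hvc t hmt).tendsto.comp htm'
  have l2 : Tendsto (fun n => ∫ s in (0 : ℝ)..τ.pt n (m n),
      derivWithin (fun t => v t (x s)) (Icc 0 T) s) atTop
      (𝓝 (∫ s in (0 : ℝ)..t, derivWithin (fun t => v t (x s)) (Icc 0 T) s)) := by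
    have hprim := intervalIntegral.continuousOn_primitive_interval (μ := volume) (a := 0) (b := u)
      (f := fun s => derivWithin (fun t => v t (x s)) (Icc 0 T) s)
      (by rw [uIcc_of_le hu0]; exact hvtc.integrableOn_Icc)
    rw [uIcc_of_le hu0] at hprim
    exact (hprim t hmt).tendsto.comp htm'
  have l3 := tendsto_sum_filter_sq_increments ⟨ht.1, ht.2.le⟩ hz (hgc.mono hItu)
    fun n i hi => τ.pt_nonneg hi.le
  simp only [hfilter] at l3
  -- The equation in the form `r (v - x v_x) = v_t + (σ² x² / 2) v_xx`.
  have hlim : v t (x t) - v 0 (x 0) - ∫ s in (0 : ℝ)..t, (v s (x s) - deriv (v s) (x s) * x s) * r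
      = v t (x t) - v 0 (x 0) - (∫ s in (0 : ℝ)..t, derivWithin (fun t => v t (x s)) (Icc 0 T) s)
        - ∫ s in (0 : ℝ)..t, σ ^ 2 * x s ^ 2 / 2 * deriv (deriv (v s)) (x s) := by
    rw [sub_sub _ (∫ s in (0 : ℝ)..t, derivWithin (fun t => v t (x s)) (Icc 0 T) s),
      ← intervalIntegral.integral_add]
    · congr 1
      refine intervalIntegral.integral_congr fun s hs => ?_
      rw [uIcc_of_le ht.1] at hs
      have := hv.pde s (hIu (hItu hs)) (x s) (hxpos s (hItu hs))
      linarith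
    · exact (hvtc.mono (by rw [uIcc_of_le ht.1]; exact hItu)).intervalIntegrable
    · exact (hgc.mono (by rw [uIcc_of_le ht.1]; exact hItu)).intervalIntegrable
  rw [hlim]
  refine ((((l1.sub_const (v 0 (x 0))).sub l2).sub l3)).congr_dist ?_
  have l4 := (tendsto_sum_sq_increments hT hz 1).eventually_lt_const
    (u := T + 1) (by simp)
  rw [Metric.tendsto_nhds]
  intro ε hε
  -- The time steps sum to at most `u` and the squared increments eventually to at most `T + 1`, so
  -- the local errors sum to less than `ε`.
  obtain ⟨δ, hδ, hloc⟩ := hv.local_expansion hσ hx₀ huT hzc hxu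
    (ε := ε / (u + T + 2)) (by positivity)
  filter_upwards [hev, l4, hmesh.eventually_lt_const hδ] with n hn hn4 hnδ
  simp only [Function.comp_apply, Real.dist_eq, sub_zero, abs_abs, follmerSum, hfilter]
  have hpt0 : ∀ i, i ≤ m n → 0 ≤ τ.pt n i := fun i hi => τ.pt_nonneg (hi.trans (hmK n))
  have hptu : ∀ i, i ≤ m n → τ.pt n i ≤ u := fun i hi => (τ.pt_le_pt hi (hmK n)).trans hn
  have hint : ∑ i ∈ Finset.range (m n), (∫ s in τ.pt n i..τ.pt n (i + 1),
      derivWithin (fun t => v t (x s)) (Icc 0 T) s)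
      = ∫ s in (0 : ℝ)..τ.pt n (m n), derivWithin (fun t => v t (x s)) (Icc 0 T) s := by
    rw [intervalIntegral.sum_integral_adjacent_intervals, τ.pt_zero]
    intro k hk
    refine (hvtc.mono ?_).intervalIntegrable
    exact uIcc_subset_Icc ⟨hpt0 k hk.le, hptu k hk.le⟩ ⟨hpt0 _ hk, hptu _ hk⟩
  have htel := Finset.sum_range_sub (fun i => v (τ.pt n i) (x (τ.pt n i))) (m n)
  have htel2 := Finset.sum_range_sub (fun i => τ.pt n i) (m n)
  simp only [τ.pt_zero] at htel htel2
  rw [← htel, ← hint, ← Finset.sum_sub_distrib, ← Finset.sum_sub_distrib, ← Finset.sum_sub_distrib]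
  have hsq : ∑ i ∈ Finset.range (m n), (z (τ.pt n (i + 1)) - z (τ.pt n i)) ^ 2 ≤ T + 1 := by
    refine le_trans ?_ hn4.le
    simp only [BoundedContinuousFunction.coe_one, Pi.one_apply, one_mul]
    exact Finset.sum_le_sum_of_subset_of_nonneg (Finset.range_mono (hmK n))
      fun _ _ _ => sq_nonneg _
  calc _ ≤ ∑ i ∈ Finset.range (m n), ε / (u + T + 2)
        * ((τ.pt n (i + 1) - τ.pt n i) + (z (τ.pt n (i + 1)) - z (τ.pt n i)) ^ 2) := by
        refine (Finset.abs_sum_le_sum_abs _ _).trans (Finset.sum_le_sum fun i hi => ?_)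
        rw [Finset.mem_range] at hi
        have hiK := hi.trans_le (hmK n)
        have := hloc (τ.pt n i) (τ.pt n (i + 1)) (hpt0 i hi.le) (τ.pt_lt n i hiK) (hptu _ hi)
          ((τ.sub_le_mesh hiK).trans_lt hnδ)
        rwa [sub_right_comm] at this
    _ ≤ ε / (u + T + 2) * (u + T + 1) := by
        rw [← Finset.mul_sum, Finset.sum_add_distrib, htel2]
        refine mul_le_mul_of_nonneg_left ?_ (by positivity)
        linarith
    _ < ε := by
        rw [div_mul_eq_mul_div, div_lt_iff₀ (by positivity)]
        nlinarith

/-- The path stays in a compact subset of `(0, ∞)`, so the gradient bound makes the integrand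
bounded on `[0, T)`; the value at `T` is on a null set. -/
theorem integrableOn_bond_position (hv : IsBlackScholesSolution T r σ h v) (hT : 0 < T)
    (hr : 0 ≤ r) (hσ : 0 < σ) {L : ℝ≥0} (hh : LipschitzOnWith L h (Ioi 0)) {x : ℝ → ℝ}
    (hx : ContinuousOn x (Icc 0 T)) (hpos : ∀ s ∈ Icc 0 T, 0 < x s) :
    IntegrableOn (fun s => v s (x s) - deriv (v s) (x s) * x s) (Icc 0 T) := by
  have hne : (Icc 0 T).Nonempty := ⟨0, le_rfl, hT.le⟩
  obtain ⟨p, hp, hpmin⟩ := isCompact_Icc.exists_isMinOn hne hx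
  obtain ⟨q, hq, hqmax⟩ := isCompact_Icc.exists_isMaxOn hne hx
  obtain ⟨A, hA⟩ := hv.exists_abs_deriv_le hr hσ hh (α := x p) (β := x q) (hpos p hp)
  have hvc : ContinuousOn (fun s => v s (x s)) (Icc 0 T) :=
    continuousOn_comp_path hv.cont hx le_rfl hpos
  have hdc : ContinuousOn (fun s => deriv (v s) (x s)) (Ico 0 T) :=
    continuousOn_comp_path hv.cont_x (hx.mono Ico_subset_Icc_self) le_rfl
      fun s hs => hpos s (Ico_subset_Icc_self hs)
  obtain ⟨M, hM⟩ := isCompact_Icc.exists_bound_of_continuousOn hvc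
  rw [integrableOn_Icc_iff_integrableOn_Ico]
  refine Integrable.of_bound ?_ (M + A * x q) ?_
  · exact ((hvc.mono Ico_subset_Icc_self).sub
      (hdc.mul (hx.mono Ico_subset_Icc_self))).aestronglyMeasurable measurableSet_Ico
  · filter_upwards [ae_restrict_mem measurableSet_Ico] with s hs
    have hs' := Ico_subset_Icc_self hs
    have h1 := hA s hs (x s) ⟨hpmin hs', hqmax hs'⟩
    refine (norm_sub_le _ _).trans (add_le_add (hM s hs') ?_)
    rw [norm_mul, Real.norm_of_nonneg (hpos s hs').le]
    exact mul_le_mul h1 (hqmax hs') (hpos s hs').le ((abs_nonneg _).trans h1)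

end IsBlackScholesSolution

/-! ### The hedging theorem -/

/-- The share terms cancel whatever value `deriv` takes, so its default value at maturity is
harmless. -/
theorem portfolioValue_deltaHedge (v : ℝ → ℝ → ℝ) (t : ℝ) (x : ℝ → ℝ) :
    portfolioValue (deltaHedge v) t x = v t (x t) := by
  simp [portfolioValue, deltaHedge]

theorem mainTheorem4 (T r σ x₀ : ℝ) (hT : 0 < T) (hr : 0 ≤ r) (hσ : 0 < σ) (hx₀ : 0 < x₀)
    (τ : PartitionSeq T) (J : Set (ℝ → ℝ)) (hJ : J ⊆ trajectoryClass τ σ x₀)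
    (h : ℝ → ℝ) (L : ℝ≥0) (hh : LipschitzOnWith L h (Ioi 0))
    (v : ℝ → ℝ → ℝ) (hv : IsBlackScholesSolution T r σ h v) :
    IsNPPortfolio J (deltaHedge v) ∧
    IsNPSelfFinancing τ r J (deltaHedge v) ∧
    ∀ x ∈ J, portfolioValue (deltaHedge v) T x = h (x T) := by
  have hpos : ∀ x ∈ J, ∀ s ∈ Icc 0 T, 0 < x s := by
    intro x hx s hs
    obtain ⟨z, -, hxz⟩ := hJ hx
    rw [hxz s hs]; positivity
  refine ⟨?_, ?_, ?_⟩
  · have h0 : ∀ x ∈ J, x 0 = x₀ := by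
      intro x hx
      obtain ⟨z, hz, hxz⟩ := hJ hx
      rw [hxz 0 ⟨le_rfl, hT.le⟩, hz.2.1, mul_zero, Real.exp_zero, mul_one]
    intro x hx x' hx'
    simp only [deltaHedge, h0 x hx, h0 x' hx']
  · intro x hx t ht
    have hxc : ContinuousOn x (Icc 0 T) := by
      obtain ⟨z, hz, hxz⟩ := hJ hx
      have hzc := hz.1
      exact ContinuousOn.congr (by fun_prop) hxz
    have hψ := hv.integrableOn_bond_position hT hr hσ hh hxc (hpos x hx)
    refine ⟨?_, v t (x t) - v 0 (x 0)
      - ∫ s in (0 : ℝ)..t, (v s (x s) - deriv (v s) (x s) * x s) * r, ?_, ?_⟩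
    · rw [intervalIntegrable_iff_integrableOn_Icc_of_le ht.1]
      exact hψ.mono_set (Icc_subset_Icc_right ht.2)
    · rcases ht.2.lt_or_eq with htT | rfl
      · exact Or.inl ⟨htT, hv.tendsto_follmerSum hσ hx₀ (hJ hx) ⟨ht.1, htT⟩⟩
      · refine Or.inr ⟨rfl, fun u => v u (x u) - v 0 (x 0)
          - ∫ s in (0 : ℝ)..u, (v s (x s) - deriv (v s) (x s) * x s) * r,
          fun u hu => hv.tendsto_follmerSum hσ hx₀ (hJ hx) ⟨hu.1.le, hu.2⟩, ?_⟩
        have hvc : ContinuousOn (fun s => v s (x s)) (Icc 0 t) :=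
          IsBlackScholesSolution.continuousOn_comp_path hv.cont hxc le_rfl (hpos x hx)
        have hprim := intervalIntegral.continuousOn_primitive_interval (μ := volume) (a := 0)
          (b := t) (f := fun s => (v s (x s) - deriv (v s) (x s) * x s) * r)
          (by rw [uIcc_of_le hT.le]; exact hψ.mul_const r)
        rw [uIcc_of_le hT.le] at hprim
        -- The integrals before `T` are given by a formula that is continuous up to `T`, so the
        -- improper integral is its value there.
        have hlim := (((hvc.sub (continuousOn_const (c := v 0 (x 0)))).sub hprim) t ht).tendsto
        refine hlim.mono_left ?_
        rw [← nhdsWithin_Ioo_eq_nhdsLT hT]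
        exact nhdsWithin_mono _ Ioo_subset_Icc_self
    · simp only [portfolioValue_deltaHedge, deltaHedge]
      ring
  · intro x hx
    rw [portfolioValue_deltaHedge, hv.terminal _ (hpos x hx T ⟨hT.le, le_rfl⟩)]
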